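/- **Corollary (Generic instability).** Let $N\in\mathbb N$, $t_0>0$, and let $G\in\mathbb{R}^{N\times N}$ have an eigenvalue $\lambda\in\mathbb{C}$ with $\lambda\notin\mathbb{R}_{\ge 0}$. Consider the NAGD dynamics $$\ddot q(t)+\frac{3}{t}\,\dot q(t)+G\,q(t)=0,\qquad t\in[t_0,\infty).$$ For every $(q_0,v_0)\in\mathbb{R}^N\times\mathbb{R}^N$ there is exactly one solution $q:[t_0,\infty)\to\mathbb{R}^N$ with $(q(t_0),\dot q(t_0))=(q_0,v_0)$; call it the trajectory of $(q_0,v_0)$. Let $$\mathcal{E}=\bigl\{(q_0,v_0)\in\mathbb{R}^N\times\mathbb{R}^N:\ \sup_{t\ge t_0}\|q(t)\|_2<\infty \text{ for the trajectory } q \text{ of } (q_0,v_0)\bigr\}.$$ Then $\mathcal{E}$ is contained in a proper linear subspace of $\mathbb{R}^{2N}$ (of dimension at most $2N-1$). Moreover: (a) $\mathcal{E}$ has Lebesgue measure zero in $\mathbb{R}^{2N}$; (b) the complement $\mathcal{E}^c$ is open and dense in $\mathbb{R}^{2N}$; (c) for Lebesgue-almost every $(q_0,v_0)\in\mathbb{R}^{2N}$,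 the trajectory satisfies $\|q(t)\|_2\to\infty$ exponentially: there is $\kappa>0$, independent of $(q_0,v_0)$, such that for almost every $(q_0,v_0)$ there are $C>0$ and $T\ge t_0$ with $\|q(t)\|_2\ge C e^{\kappa t}$ for all $t\ge T$. -/

import Mathlib

open Set Filter Topology MeasureTheory

/-- `q` solves `q'' + (3/t) q' + G q = 0` on `[t₀, ∞)` with `q t₀ = q₀` and `q' t₀ = v₀`.
Here `v` is the velocity `q'`; derivatives are within `[t₀, ∞)`, hence one-sided at `t₀`
and two-sided at every later time. Values of `q` before `t₀` are irrelevant. -/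
def IsNAGDTrajectory {N : ℕ} (G : Matrix (Fin N) (Fin N) ℝ) (t₀ : ℝ)
    (q₀ v₀ : EuclideanSpace ℝ (Fin N)) (q : ℝ → EuclideanSpace ℝ (Fin N)) : Prop :=
  ∃ v : ℝ → EuclideanSpace ℝ (Fin N),
    q t₀ = q₀ ∧ v t₀ = v₀ ∧
    (∀ t ∈ Ici t₀, HasDerivWithinAt q (v t) (Ici t₀) t) ∧
    (∀ t ∈ Ici t₀, HasDerivWithinAt v
      (-((3 / t) • v t) - WithLp.toLp 2 (G.mulVec (q t).ofLp)) (Ici t₀) t)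

/-- The initial conditions `(q₀, v₀)` at time `t₀` whose trajectory stays bounded. -/
def boundedInitialConditions {N : ℕ} (G : Matrix (Fin N) (Fin N) ℝ) (t₀ : ℝ) :
    Set (EuclideanSpace ℝ (Fin N) × EuclideanSpace ℝ (Fin N)) :=
  {z | ∃ q : ℝ → EuclideanSpace ℝ (Fin N),
    IsNAGDTrajectory G t₀ z.1 z.2 q ∧ ∃ M : ℝ, ∀ t ∈ Ici t₀, ‖q t‖ ≤ M}

/-! Write `lam = -μ²` with `a = Re μ > 0`. A left eigenvector of `G` gives a functional `ℓ` for
which `y = ℓ ∘ q` solves `y'' + (3/t) y' = μ² y`, so a scalar dichotomy suffices, and it needs no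
special-function asymptotics. With `J = Re (conj (μ y) * y')` and `E = |y'|² + |μ y|²`, `J' = a E -
(3/t) J`, `E' = 4 a J - (6/t) |y'|²`, `2 J ≤ E`. If `J ≤ 0` throughout, `E` is nonincreasing and `y`
is bounded. If `J > 0` once, `t³ J e^(-2at)` stays above a positive constant while `|y'|` is at most
a multiple of `e^(at)`; since `J ≤ |μ y| |y'|`, `|y|` is at least a multiple of `t⁻³ e^(at)`.

Initial data with `ℓ ∘ q` bounded form a subspace. It misses `(x, x)` when `ℓ x ≠ 0`, because there
`J(t₀) = a |ℓ x|² > 0`. A proper subspace is closed, null and has dense complement, and off it the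
dichotomy forces exponential growth. -/

/-! ### Global existence and uniqueness for Lipschitz fields -/

/-- Gluing solutions of an ODE along adjacent intervals. -/
theorem IsIntegralCurveOn.glue_Icc {X : Type*} [NormedAddCommGroup X] [NormedSpace ℝ X]
    {f : ℝ → X → X} {a b c : ℝ} (hab : a ≤ b) (hbc : b ≤ c) {x y : ℝ → X}
    (hx : IsIntegralCurveOn x f (Icc a b)) (hy : IsIntegralCurveOn y f (Icc b c))
    (hxy : x b = y b) :
    IsIntegralCurveOn (fun t => if t ≤ b then x t else y t) f (Icc a c) := by
  set z : ℝ → X := fun t => if t ≤ b then x t else y t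
  have zx : EqOn z x (Icc a b) := fun t ht => if_pos ht.2
  have zy : EqOn z y (Icc b c) := by
    intro t ht
    rcases ht.1.eq_or_lt with rfl | h
    · simp [z, hxy]
    · exact if_neg h.not_ge
  have hzx : IsIntegralCurveOn z f (Icc a b) := fun t ht => by
    rw [zx ht]
    exact (hx t ht).congr zx (zx ht)
  have hzy : IsIntegralCurveOn z f (Icc b c) := fun t ht => by
    rw [zy ht]
    exact (hy t ht).congr zy (zy ht)
  intro t ht
  rcases lt_trichotomy t b with h | rfl | h
  · refine (hzx t ⟨ht.1, h.le⟩).mono_of_mem_nhdsWithin ?_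
    filter_upwards [self_mem_nhdsWithin, mem_nhdsWithin_of_mem_nhds (Iio_mem_nhds h)] with s hs hs'
    exact ⟨hs.1, hs'.le⟩
  · rw [← Icc_union_Icc_eq_Icc hab hbc]
    exact (hzx t ⟨hab, le_rfl⟩).union (hzy t ⟨le_rfl, hbc⟩)
  · refine (hzy t ⟨h.le, ht.2⟩).mono_of_mem_nhdsWithin ?_
    filter_upwards [self_mem_nhdsWithin, mem_nhdsWithin_of_mem_nhds (Ioi_mem_nhds h)] with s hs hs'
    exact ⟨hs'.le, hs.2⟩

/-- Uniqueness on an interval for a vector field that is Lipschitz in space. -/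
theorem IsIntegralCurveOn.eqOn_Icc_of_lipschitz {X : Type*} [NormedAddCommGroup X]
    [NormedSpace ℝ X] {f : ℝ → X → X} {a b : ℝ} {K : NNReal}
    (hf : ∀ t ∈ Ici a, LipschitzWith K (f t)) {x y : ℝ → X}
    (hx : IsIntegralCurveOn x f (Icc a b)) (hy : IsIntegralCurveOn y f (Icc a b))
    (hxy : x a = y a) : EqOn x y (Icc a b) := by
  have key : ∀ z : ℝ → X, IsIntegralCurveOn z f (Icc a b) →
      ∀ t ∈ Ico a b, HasDerivWithinAt z (f t (z t)) (Ici t) t := fun z hz t ht =>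
    (hz t ⟨ht.1, ht.2.le⟩).mono_of_mem_nhdsWithin <| by
      filter_upwards [self_mem_nhdsWithin, mem_nhdsWithin_of_mem_nhds (Iio_mem_nhds ht.2)]
        with s hs hs'
      exact ⟨ht.1.trans hs, hs'.le⟩
  exact ODE_solution_unique_of_mem_Icc_right (s := fun _ => univ)
    (fun t ht => (hf t ht.1).lipschitzOnWith) hx.continuousOn (key x hx) (fun _ _ => trivial)
    hy.continuousOn (key y hy) (fun _ _ => trivial) hxy

/-- Global existence on `[a, ∞)` for a vector field that is uniformly Lipschitz in space,
continuous in time, and vanishes at the origin. -/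
theorem exists_isIntegralCurveOn_Ici {X : Type*} [NormedAddCommGroup X] [NormedSpace ℝ X]
    [CompleteSpace X] {f : ℝ → X → X} {a : ℝ} {K : NNReal}
    (hf : ∀ t ∈ Ici a, LipschitzWith K (f t)) (hf0 : ∀ t ∈ Ici a, f t 0 = 0)
    (hcont : ∀ x, ContinuousOn (fun t => f t x) (Ici a)) (x₀ : X) :
    ∃ x : ℝ → X, x a = x₀ ∧ IsIntegralCurveOn x f (Ici a) := by
  -- The step length depends on `K` only: on the ball of radius `‖z‖ + 1` about `z` the field is at
  -- most `K (2‖z‖ + 1)`, and `K h ≤ 1/2` keeps the curve in that ball. The `+ 1` covers `K = 0`.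
  set h : ℝ := 1 / (2 * (K + 1)) with hh
  have hK : (0 : ℝ) ≤ K := K.2
  have hpos : 0 < h := by positivity
  have hKh : K * h ≤ 1 / 2 := by
    rw [hh, mul_one_div, div_le_div_iff₀ (by positivity) (by norm_num)]
    linarith
  have hloc : ∀ b ∈ Ici a, ∀ z : X, ∃ x : ℝ → X, x b = z ∧
      IsIntegralCurveOn x f (Icc b (b + h)) := by
    intro b hb z
    have hsub : Icc b (b + h) ⊆ Ici a := fun t ht => le_trans hb ht.1
    have hpl : IsPicardLindelof f (tmin := b) (tmax := b + h) ⟨b, le_rfl, by linarith⟩ z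
        (‖z‖₊ + 1) 0 (K * (2 * ‖z‖₊ + 1)) K := by
      refine ⟨fun t ht => (hf t (hsub ht)).lipschitzOnWith, fun x _ => (hcont x).mono hsub, ?_, ?_⟩
      · intro t ht x hx
        have h1 := (hf t (hsub ht)).norm_sub_le x 0
        rw [hf0 t (hsub ht), sub_zero, sub_zero] at h1
        have h2 : ‖x - z‖ ≤ ‖z‖ + 1 := by simpa [dist_eq_norm] using hx
        have h3 : ‖x‖ ≤ ‖x - z‖ + ‖z‖ := by simpa using norm_add_le (x - z) z
        push_cast
        exact h1.trans (mul_le_mul_of_nonneg_left (by linarith) hK)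
      · have : max (b + h - b) (b - b) = h := by rw [sub_self, add_sub_cancel_left, max_eq_left hpos.le]
        simp only [this]
        push_cast
        nlinarith [norm_nonneg z]
    exact hpl.exists_eq_forall_mem_Icc_hasDerivWithinAt₀
  have hstep : ∀ n : ℕ, ∃ x : ℝ → X, x a = x₀ ∧ IsIntegralCurveOn x f (Icc a (a + n * h)) := by
    intro n
    induction n with
    | zero =>
      obtain ⟨x, hx, hx'⟩ := hloc a self_mem_Ici x₀
      exact ⟨x, hx, hx'.mono (Icc_subset_Icc_right (by simpa using hpos.le))⟩
    | succ n ih =>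
      obtain ⟨x, hx, hx'⟩ := ih
      have hab : a ≤ a + n * h := by
        have : (0 : ℝ) ≤ n * h := by positivity
        linarith
      obtain ⟨y, hy, hy'⟩ := hloc (a + n * h) hab (x (a + n * h))
      refine ⟨_, ?_, by
        have := hx'.glue_Icc hab (by linarith) hy' hy.symm
        convert this using 2
        push_cast; ring⟩
      simpa [hab] using hx
  choose x hx hx' using hstep
  have hmono : ∀ m n : ℕ, m ≤ n → EqOn (x m) (x n) (Icc a (a + m * h)) := fun m n hmn =>
    (hx' m).eqOn_Icc_of_lipschitz hf
      ((hx' n).mono (Icc_subset_Icc_right (by gcongr))) ((hx m).trans (hx n).symm)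
  -- Strict inequality makes the chosen interval a neighbourhood of `t` within `Ici a`, so
  -- derivatives transfer.
  have hcover : ∀ t : ℝ, t < a + (⌊(t - a) / h⌋₊ + 1 : ℕ) * h := by
    intro t
    have := Nat.lt_floor_add_one ((t - a) / h)
    rw [div_lt_iff₀ hpos] at this
    push_cast
    linarith
  set N : ℝ → ℕ := fun t => ⌊(t - a) / h⌋₊ + 1
  have hz : ∀ n : ℕ, EqOn (fun t => x (N t) t) (x n) (Icc a (a + n * h)) := by
    intro n t ht
    rcases le_total (N t) n with hn | hn
    · exact hmono _ _ hn ⟨ht.1, (hcover t).le⟩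
    · exact (hmono _ _ hn ht).symm
  refine ⟨fun t => x (N t) t, hx _, fun t ht => ?_⟩
  have hmem : t ∈ Icc a (a + N t * h) := ⟨ht, (hcover t).le⟩
  refine ((hx' (N t) t hmem).congr (hz (N t)) (hz (N t) hmem)).mono_of_mem_nhdsWithin ?_
  filter_upwards [self_mem_nhdsWithin, mem_nhdsWithin_of_mem_nhds (Iio_mem_nhds (hcover t))]
    with s hs hs'
  exact ⟨hs, hs'.le⟩

/-! ### The scalar dichotomy -/

/-- The complex scalar equation `y'' + (3/t) y' = μ² y` on `[t₀, ∞)`, as a first-order system. -/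
structure IsScalarNAGD (μ : ℂ) (t₀ : ℝ) (y v : ℝ → ℂ) : Prop where
  hasDeriv_pos : ∀ t ∈ Ici t₀, HasDerivWithinAt y (v t) (Ici t₀) t
  hasDeriv_vel : ∀ t ∈ Ici t₀,
    HasDerivWithinAt v (-((3 / t : ℝ) • v t) + μ ^ 2 * y t) (Ici t₀) t

namespace IsScalarNAGD

variable {μ : ℂ} {t₀ : ℝ} {y v : ℝ → ℂ}

/-- The correlation of `μ y` with `y'`, whose sign separates growing from bounded solutions. -/
noncomputable def corr (μ : ℂ) (y v : ℝ → ℂ) (t : ℝ) : ℝ := inner ℝ (μ * y t) (v t)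

/-- The energy `|y'|² + |μ y|²`. -/
noncomputable def energy (μ : ℂ) (y v : ℝ → ℂ) (t : ℝ) : ℝ := ‖v t‖ ^ 2 + ‖μ * y t‖ ^ 2

/-- The difference of the two sides is `‖v - μ y‖²`. -/
theorem two_mul_corr_le (t : ℝ) : 2 * corr μ y v t ≤ energy μ y v t := by
  have h := real_inner_le_norm (μ * y t) (v t)
  unfold corr energy
  nlinarith [sq_nonneg (‖v t‖ - ‖μ * y t‖)]

theorem hasDerivWithinAt_corr (h : IsScalarNAGD μ t₀ y v) {t : ℝ} (ht : t ∈ Ici t₀) :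
    HasDerivWithinAt (corr μ y v) (μ.re * energy μ y v t - 3 / t * corr μ y v t) (Ici t₀) t := by
  refine (((h.hasDeriv_pos t ht).const_mul μ).inner ℝ (h.hasDeriv_vel t ht)).congr_deriv ?_
  simp only [corr, energy, Complex.inner, Complex.sq_norm, Complex.normSq_apply]
  simp [pow_two]
  ring

theorem hasDerivWithinAt_energy (h : IsScalarNAGD μ t₀ y v) {t : ℝ} (ht : t ∈ Ici t₀) :
    HasDerivWithinAt (energy μ y v) (4 * μ.re * corr μ y v t - 6 / t * ‖v t‖ ^ 2) (Ici t₀) t := by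
  refine ((h.hasDeriv_vel t ht).norm_sq.add
    ((h.hasDeriv_pos t ht).const_mul μ).norm_sq).congr_deriv ?_
  simp only [corr, Complex.inner, Complex.sq_norm, Complex.normSq_apply]
  simp [pow_two]
  ring

/-- The factor `t³` cancels the damping term of `J'`; what remains is a nonnegative multiple of `E -
2 J`. -/
theorem monotoneOn_corr (h : IsScalarNAGD μ t₀ y v) (ht₀ : 0 < t₀) (hμ : 0 < μ.re) :
    MonotoneOn (fun t => t ^ 3 * corr μ y v t * Real.exp (-(2 * μ.re * t))) (Ici t₀) := by
  have key : ∀ t ∈ Ici t₀, HasDerivWithinAt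
      (fun t => t ^ 3 * corr μ y v t * Real.exp (-(2 * μ.re * t)))
      (t ^ 3 * μ.re * (energy μ y v t - 2 * corr μ y v t) * Real.exp (-(2 * μ.re * t)))
      (Ici t₀) t := by
    intro t ht
    have htne : t ≠ 0 := (ht₀.trans_le ht).ne'
    refine (((hasDerivAt_pow 3 t).hasDerivWithinAt.mul (h.hasDerivWithinAt_corr ht)).mul
      (((hasDerivAt_id t).const_mul (2 * μ.re)).neg.exp.hasDerivWithinAt)).congr_deriv ?_
    simp
    field_simp
    ring
  refine monotoneOn_of_hasDerivWithinAt_nonneg (convex_Ici t₀)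
    (fun t ht => (key t ht).continuousWithinAt)
    (fun t ht => (key t (interior_subset ht)).mono interior_subset) fun t ht => ?_
  have : 0 < t := ht₀.trans_le (interior_subset ht)
  have := two_mul_corr_le (μ := μ) (y := y) (v := v) t
  have : 0 ≤ energy μ y v t - 2 * corr μ y v t := by linarith
  positivity

/-- Energy grows at rate at most `2 a`, since `4 a J ≤ 2 a E` and damping only dissipates. -/
theorem antitoneOn_energy_mul_exp (h : IsScalarNAGD μ t₀ y v) (ht₀ : 0 < t₀) (hμ : 0 < μ.re) :
    AntitoneOn (fun t => energy μ y v t * Real.exp (-(2 * μ.re * t))) (Ici t₀) := by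
  have key : ∀ t ∈ Ici t₀, HasDerivWithinAt
      (fun t => energy μ y v t * Real.exp (-(2 * μ.re * t)))
      (-((2 * μ.re * (energy μ y v t - 2 * corr μ y v t) + 6 / t * ‖v t‖ ^ 2) *
        Real.exp (-(2 * μ.re * t)))) (Ici t₀) t := by
    intro t ht
    refine ((h.hasDerivWithinAt_energy ht).mul
      (((hasDerivAt_id t).const_mul (2 * μ.re)).neg.exp.hasDerivWithinAt)).congr_deriv ?_
    simp
    ring
  refine antitoneOn_of_hasDerivWithinAt_nonpos (convex_Ici t₀)
    (fun t ht => (key t ht).continuousWithinAt)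
    (fun t ht => (key t (interior_subset ht)).mono interior_subset) fun t ht => ?_
  have : 0 < t := ht₀.trans_le (interior_subset ht)
  have := two_mul_corr_le (μ := μ) (y := y) (v := v) t
  have : 0 ≤ energy μ y v t - 2 * corr μ y v t := by linarith
  exact neg_nonpos.2 (by positivity)

/-- If the correlation never becomes positive, the solution is bounded. -/
theorem bounded_of_corr_nonpos (h : IsScalarNAGD μ t₀ y v) (ht₀ : 0 < t₀) (hμ : 0 < μ.re)
    (hJ : ∀ t ∈ Ici t₀, corr μ y v t ≤ 0) : ∃ M, ∀ t ∈ Ici t₀, ‖y t‖ ≤ M := by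
  have hμ0 : 0 < ‖μ‖ := norm_pos_iff.2 fun h0 => by simp [h0] at hμ
  have hanti : AntitoneOn (energy μ y v) (Ici t₀) := by
    refine antitoneOn_of_hasDerivWithinAt_nonpos (convex_Ici t₀)
      (fun t ht => (h.hasDerivWithinAt_energy ht).continuousWithinAt)
      (fun t ht => (h.hasDerivWithinAt_energy (interior_subset ht)).mono interior_subset)
      fun t ht => ?_
    have h0 : 0 < t := ht₀.trans_le (interior_subset ht)
    have h1 := mul_nonpos_of_nonneg_of_nonpos hμ.le (hJ t (interior_subset ht))
    have h2 : 0 ≤ 6 / t * ‖v t‖ ^ 2 := by positivity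
    linarith
  refine ⟨√(energy μ y v t₀) / ‖μ‖, fun t ht => ?_⟩
  rw [le_div_iff₀ hμ0, mul_comm, ← norm_mul]
  refine Real.le_sqrt_of_sq_le (le_trans ?_ (hanti self_mem_Ici ht ht))
  exact le_add_of_nonneg_left (sq_nonneg _)

/-- If the correlation is positive at some time, the solution grows exponentially. -/
theorem exp_growth_of_corr_pos (h : IsScalarNAGD μ t₀ y v) (ht₀ : 0 < t₀) (hμ : 0 < μ.re)
    {t₁ : ℝ} (ht₁ : t₁ ∈ Ici t₀) (hJ : 0 < corr μ y v t₁) :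
    ∃ C : ℝ, 0 < C ∧ ∀ᶠ t in atTop, C * Real.exp (μ.re / 2 * t) ≤ ‖y t‖ := by
  have hμ0 : 0 < ‖μ‖ := norm_pos_iff.2 fun h0 => by simp [h0] at hμ
  set a := μ.re
  set c : ℝ := t₁ ^ 3 * corr μ y v t₁ * Real.exp (-(2 * a * t₁))
  have hc : 0 < c := by
    have : 0 < t₁ := ht₀.trans_le ht₁
    positivity
  set M : ℝ := √(energy μ y v t₁ * Real.exp (-(2 * a * t₁))) + 1
  have hM : 0 < M := by positivity
  refine ⟨c / (‖μ‖ * M), by positivity, ?_⟩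
  -- Half of the rate `a` is given up to absorb the factor `t³`.
  have hexp : ∀ᶠ t : ℝ in atTop, t ^ 3 ≤ Real.exp (a / 2 * t) := by
    have := (isLittleO_pow_exp_pos_mul_atTop 3 (half_pos hμ)).bound one_pos
    filter_upwards [this, eventually_ge_atTop 0] with t ht ht0
    simpa [abs_of_nonneg ht0] using ht
  filter_upwards [hexp, eventually_ge_atTop t₁] with t ht htt₁
  have htmem : t ∈ Ici t₀ := le_trans ht₁ htt₁
  have htpos : 0 < t := ht₀.trans_le htmem
  have hE : Real.exp (2 * a * t) = Real.exp (a * t) ^ 2 := by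
    rw [← Real.exp_nat_mul]; congr 1; push_cast; ring
  have h1 : c * Real.exp (a * t) ^ 2 ≤ t ^ 3 * corr μ y v t := by
    have := h.monotoneOn_corr ht₀ hμ ht₁ htmem htt₁
    simp only [Real.exp_neg (2 * μ.re * t)] at this
    rw [← div_eq_mul_inv, le_div_iff₀ (Real.exp_pos _)] at this
    rwa [← hE]
  have h2 : ‖v t‖ ≤ M * Real.exp (a * t) := by
    have h3 := h.antitoneOn_energy_mul_exp ht₀ hμ ht₁ htmem htt₁
    have h4 : (‖v t‖ * Real.exp (-(a * t))) ^ 2 ≤ energy μ y v t * Real.exp (-(2 * a * t)) := by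
      have : Real.exp (-(2 * a * t)) = Real.exp (-(a * t)) ^ 2 := by
        rw [← Real.exp_nat_mul]; congr 1; push_cast; ring
      rw [this, mul_pow]
      gcongr
      exact le_add_of_nonneg_right (sq_nonneg _)
    have h5 := (Real.le_sqrt_of_sq_le (h4.trans h3)).trans (le_add_of_nonneg_right zero_le_one)
    rwa [Real.exp_neg (a * t), ← div_eq_mul_inv, div_le_iff₀ (Real.exp_pos _)] at h5
  have h3 : corr μ y v t ≤ ‖μ‖ * ‖y t‖ * (M * Real.exp (a * t)) := by
    refine (real_inner_le_norm _ _).trans ?_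
    rw [norm_mul]
    gcongr
  have h4 : c * Real.exp (a * t) ≤ t ^ 3 * (‖μ‖ * M * ‖y t‖) := by
    refine le_of_mul_le_mul_right ?_ (Real.exp_pos (a * t))
    calc c * Real.exp (a * t) * Real.exp (a * t) = c * Real.exp (a * t) ^ 2 := by ring
      _ ≤ t ^ 3 * corr μ y v t := h1
      _ ≤ t ^ 3 * (‖μ‖ * ‖y t‖ * (M * Real.exp (a * t))) := by gcongr
      _ = _ := by ring
  rw [div_mul_eq_mul_div, div_le_iff₀ (by positivity)]
  refine le_of_mul_le_mul_right ?_ (Real.exp_pos (a / 2 * t))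
  calc c * Real.exp (a / 2 * t) * Real.exp (a / 2 * t) = c * Real.exp (a * t) := by
        rw [mul_assoc, ← Real.exp_add]; congr 2; ring
    _ ≤ t ^ 3 * (‖μ‖ * M * ‖y t‖) := h4
    _ ≤ Real.exp (a / 2 * t) * (‖μ‖ * M * ‖y t‖) := by gcongr
    _ = _ := by ring

end IsScalarNAGD

/-! ### The dynamics as a linear system in phase space -/

namespace IsNAGDTrajectory

variable {N : ℕ} {G : Matrix (Fin N) (Fin N) ℝ} {t₀ : ℝ}

/-- The conservative part `(q, v) ↦ (v, -G q)` of the phase-space vector field. -/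
noncomputable def conservativePart (G : Matrix (Fin N) (Fin N) ℝ) :
    EuclideanSpace ℝ (Fin N) × EuclideanSpace ℝ (Fin N) →L[ℝ]
      EuclideanSpace ℝ (Fin N) × EuclideanSpace ℝ (Fin N) :=
  (ContinuousLinearMap.snd ℝ (EuclideanSpace ℝ (Fin N)) (EuclideanSpace ℝ (Fin N))).prod
    (-((Matrix.toLpLin 2 2 G).toContinuousLinearMap ∘L
      ContinuousLinearMap.fst ℝ (EuclideanSpace ℝ (Fin N)) (EuclideanSpace ℝ (Fin N))))

/-- The damping part `(q, v) ↦ (0, -v)` of the phase-space vector field. -/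
noncomputable def dampingPart (N : ℕ) :
    EuclideanSpace ℝ (Fin N) × EuclideanSpace ℝ (Fin N) →L[ℝ]
      EuclideanSpace ℝ (Fin N) × EuclideanSpace ℝ (Fin N) :=
  ContinuousLinearMap.prod 0
    (-ContinuousLinearMap.snd ℝ (EuclideanSpace ℝ (Fin N)) (EuclideanSpace ℝ (Fin N)))

/-- The phase-space vector field of the NAGD dynamics at time `t`. -/
noncomputable def field (G : Matrix (Fin N) (Fin N) ℝ) (t : ℝ) :
    EuclideanSpace ℝ (Fin N) × EuclideanSpace ℝ (Fin N) →L[ℝ]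
      EuclideanSpace ℝ (Fin N) × EuclideanSpace ℝ (Fin N) :=
  conservativePart G + (3 / t) • dampingPart N

theorem field_apply (t : ℝ) (z : EuclideanSpace ℝ (Fin N) × EuclideanSpace ℝ (Fin N)) :
    field G t z = (z.2, -((3 / t) • z.2) - WithLp.toLp 2 (G.mulVec z.1.ofLp)) := by
  ext1
  · simp [field, conservativePart, dampingPart]
  · simp [field, conservativePart, dampingPart, Matrix.toLpLin_apply]
    abel

theorem exists_lipschitzWith_field (G : Matrix (Fin N) (Fin N) ℝ) (ht₀ : 0 < t₀) :
    ∃ K : NNReal, ∀ t ∈ Ici t₀, LipschitzWith K (field G t) := by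
  -- The damping coefficient `3 / t` is largest at `t₀`.
  refine ⟨⟨‖conservativePart G‖ + 3 / t₀ * ‖dampingPart N‖, by positivity⟩, fun t ht => ?_⟩
  refine (field G t).lipschitz.weaken ?_
  have h0 : 0 < t := ht₀.trans_le ht
  change ‖conservativePart G + (3 / t) • dampingPart N‖ ≤ ‖conservativePart G‖ + 3 / t₀ * ‖dampingPart N‖
  refine (norm_add_le _ _).trans ?_
  rw [norm_smul, Real.norm_of_nonneg (by positivity)]
  gcongr
  exact ht

theorem continuousOn_field (ht₀ : 0 < t₀)
    (z : EuclideanSpace ℝ (Fin N) × EuclideanSpace ℝ (Fin N)) :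
    ContinuousOn (fun t => field G t z) (Ici t₀) := by
  have h : ContinuousOn (fun t : ℝ => 3 / t) (Ici t₀) :=
    continuousOn_const.div continuousOn_id fun t ht => (ht₀.trans_le ht).ne'
  simp only [field_apply]
  fun_prop

theorem iff_exists_isIntegralCurveOn {q₀ v₀ : EuclideanSpace ℝ (Fin N)}
    {q : ℝ → EuclideanSpace ℝ (Fin N)} :
    IsNAGDTrajectory G t₀ q₀ v₀ q ↔ ∃ v : ℝ → EuclideanSpace ℝ (Fin N),
      (q t₀, v t₀) = (q₀, v₀) ∧
        IsIntegralCurveOn (fun t => (q t, v t)) (fun t => field G t) (Ici t₀) := by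
  refine exists_congr fun v => ?_
  rw [Prod.mk.injEq, and_assoc]
  refine and_congr_right fun _ => and_congr_right fun _ => ⟨fun h t ht => ?_, fun h => ⟨?_, ?_⟩⟩
  · simp only [field_apply]
    exact (h.1 t ht).prodMk (h.2 t ht)
  · intro t ht
    have := h t ht
    simp only [field_apply] at this
    exact (ContinuousLinearMap.fst ℝ _ _).hasFDerivAt.comp_hasDerivWithinAt t this
  · intro t ht
    have := h t ht
    simp only [field_apply] at this
    exact (ContinuousLinearMap.snd ℝ _ _).hasFDerivAt.comp_hasDerivWithinAt t this

theorem exists_trajectory (G : Matrix (Fin N) (Fin N) ℝ) (ht₀ : 0 < t₀)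
    (q₀ v₀ : EuclideanSpace ℝ (Fin N)) : ∃ q, IsNAGDTrajectory G t₀ q₀ v₀ q := by
  obtain ⟨K, hK⟩ := exists_lipschitzWith_field G ht₀
  obtain ⟨x, hx, hx'⟩ := exists_isIntegralCurveOn_Ici (f := fun t => field G t) hK
    (fun t _ => map_zero _) (continuousOn_field ht₀) (q₀, v₀)
  exact ⟨fun t => (x t).1, iff_exists_isIntegralCurveOn.2 ⟨fun t => (x t).2, hx, hx'⟩⟩

theorem eqOn (ht₀ : 0 < t₀) {q₀ v₀ : EuclideanSpace ℝ (Fin N)}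
    {p q : ℝ → EuclideanSpace ℝ (Fin N)} (hp : IsNAGDTrajectory G t₀ q₀ v₀ p)
    (hq : IsNAGDTrajectory G t₀ q₀ v₀ q) : EqOn p q (Ici t₀) := by
  obtain ⟨K, hK⟩ := exists_lipschitzWith_field G ht₀
  obtain ⟨u, hu, hu'⟩ := iff_exists_isIntegralCurveOn.1 hp
  obtain ⟨v, hv, hv'⟩ := iff_exists_isIntegralCurveOn.1 hq
  intro t ht
  exact congrArg Prod.fst <| IsIntegralCurveOn.eqOn_Icc_of_lipschitz (f := fun t => field G t) hK
    (hu'.mono Icc_subset_Ici_self) (hv'.mono Icc_subset_Ici_self) (hu.trans hv.symm)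
    ⟨ht, le_rfl⟩

theorem add {q₀ v₀ p₀ u₀ : EuclideanSpace ℝ (Fin N)} {p q : ℝ → EuclideanSpace ℝ (Fin N)}
    (hq : IsNAGDTrajectory G t₀ q₀ v₀ q) (hp : IsNAGDTrajectory G t₀ p₀ u₀ p) :
    IsNAGDTrajectory G t₀ (q₀ + p₀) (v₀ + u₀) (q + p) := by
  obtain ⟨v, hv, hv'⟩ := iff_exists_isIntegralCurveOn.1 hq
  obtain ⟨u, hu, hu'⟩ := iff_exists_isIntegralCurveOn.1 hp
  refine iff_exists_isIntegralCurveOn.2 ⟨v + u, ?_, fun t ht => ?_⟩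
  · rw [← Prod.mk_add_mk, ← hv, ← hu]
    rfl
  · exact ((hv' t ht).add (hu' t ht)).congr_deriv (map_add (field G t) _ _).symm

theorem const_smul {q₀ v₀ : EuclideanSpace ℝ (Fin N)} {q : ℝ → EuclideanSpace ℝ (Fin N)}
    (hq : IsNAGDTrajectory G t₀ q₀ v₀ q) (c : ℝ) :
    IsNAGDTrajectory G t₀ (c • q₀) (c • v₀) (c • q) := by
  obtain ⟨v, hv, hv'⟩ := iff_exists_isIntegralCurveOn.1 hq
  refine iff_exists_isIntegralCurveOn.2 ⟨c • v, ?_, fun t ht => ?_⟩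
  · rw [← Prod.smul_mk, ← hv]
    rfl
  · exact ((hv' t ht).const_smul c).congr_deriv (map_smul (field G t) _ _).symm

theorem zero : IsNAGDTrajectory G t₀ 0 0 0 :=
  iff_exists_isIntegralCurveOn.2 ⟨0, rfl, fun t _ =>
    (hasDerivWithinAt_const t _ (0 : EuclideanSpace ℝ (Fin N) × EuclideanSpace ℝ (Fin N))).congr_deriv
      (map_zero (field G t)).symm⟩

/-- A left eigenvector turns a trajectory into a solution of the scalar equation. -/
theorem exists_isScalarNAGD {q₀ v₀ : EuclideanSpace ℝ (Fin N)}
    {q : ℝ → EuclideanSpace ℝ (Fin N)} (hq : IsNAGDTrajectory G t₀ q₀ v₀ q) {μ : ℂ}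
    {ℓ : EuclideanSpace ℝ (Fin N) →L[ℝ] ℂ}
    (hℓ : ∀ x : EuclideanSpace ℝ (Fin N), ℓ (WithLp.toLp 2 (G.mulVec x.ofLp)) = -(μ ^ 2) * ℓ x) :
    ∃ u : ℝ → ℂ, u t₀ = ℓ v₀ ∧ IsScalarNAGD μ t₀ (fun t => ℓ (q t)) u := by
  obtain ⟨v, -, hv0, h1, h2⟩ := hq
  refine ⟨fun t => ℓ (v t), by simp only [hv0], fun t ht => ?_, fun t ht => ?_⟩
  · exact ℓ.hasFDerivAt.comp_hasDerivWithinAt t (h1 t ht)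
  · refine (ℓ.hasFDerivAt.comp_hasDerivWithinAt t (h2 t ht)).congr_deriv ?_
    rw [map_sub, map_neg, map_smul, hℓ]
    ring

end IsNAGDTrajectory

/-! ### Bounded observables and left eigenvectors -/

/-- The initial conditions whose trajectory has a bounded image under `ℓ`. -/
noncomputable def boundedObservable {N : ℕ} (G : Matrix (Fin N) (Fin N) ℝ) (t₀ : ℝ) {F : Type*}
    [NormedAddCommGroup F] [NormedSpace ℝ F] (ℓ : EuclideanSpace ℝ (Fin N) →L[ℝ] F) :
    Submodule ℝ (EuclideanSpace ℝ (Fin N) × EuclideanSpace ℝ (Fin N)) where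
  carrier := {z | ∃ q, IsNAGDTrajectory G t₀ z.1 z.2 q ∧ ∃ M : ℝ, ∀ t ∈ Ici t₀, ‖ℓ (q t)‖ ≤ M}
  zero_mem' := ⟨0, .zero, 0, fun t _ => by simp⟩
  add_mem' := by
    rintro z w ⟨q, hq, M, hM⟩ ⟨p, hp, M', hM'⟩
    refine ⟨q + p, hq.add hp, M + M', fun t ht => ?_⟩
    rw [Pi.add_apply, map_add]
    exact (norm_add_le _ _).trans (add_le_add (hM t ht) (hM' t ht))
  smul_mem' := by
    rintro c z ⟨q, hq, M, hM⟩
    refine ⟨c • q, hq.const_smul c, ‖c‖ * M, fun t ht => ?_⟩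
    rw [Pi.smul_apply, map_smul, norm_smul]
    exact mul_le_mul_of_nonneg_left (hM t ht) (norm_nonneg c)

theorem mem_boundedObservable {N : ℕ} {G : Matrix (Fin N) (Fin N) ℝ} {t₀ : ℝ} {F : Type*}
    [NormedAddCommGroup F] [NormedSpace ℝ F] {ℓ : EuclideanSpace ℝ (Fin N) →L[ℝ] F}
    {z : EuclideanSpace ℝ (Fin N) × EuclideanSpace ℝ (Fin N)} :
    z ∈ boundedObservable G t₀ ℓ ↔
      ∃ q, IsNAGDTrajectory G t₀ z.1 z.2 q ∧ ∃ M : ℝ, ∀ t ∈ Ici t₀, ‖ℓ (q t)‖ ≤ M :=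
  Iff.rfl

theorem coe_boundedObservable_id {N : ℕ} (G : Matrix (Fin N) (Fin N) ℝ) (t₀ : ℝ) :
    (boundedObservable G t₀ (ContinuousLinearMap.id ℝ _) : Set _) =
      boundedInitialConditions G t₀ :=
  rfl

theorem boundedObservable_id_le {N : ℕ} (G : Matrix (Fin N) (Fin N) ℝ) (t₀ : ℝ) {F : Type*}
    [NormedAddCommGroup F] [NormedSpace ℝ F] (ℓ : EuclideanSpace ℝ (Fin N) →L[ℝ] F) :
    boundedObservable G t₀ (ContinuousLinearMap.id ℝ _) ≤ boundedObservable G t₀ ℓ := by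
  rintro z ⟨q, hq, M, hM⟩
  exact ⟨q, hq, ‖ℓ‖ * M, fun t ht => (ℓ.le_opNorm _).trans
    (mul_le_mul_of_nonneg_left (hM t ht) (norm_nonneg _))⟩

/-- Every complex eigenvalue of a real matrix is witnessed by a real-linear functional
`ℓ x = ∑ wᵢ xᵢ` given by a left eigenvector; it does not vanish on some real vector. -/
theorem exists_left_eigenfunctional {N : ℕ} {G : Matrix (Fin N) (Fin N) ℝ} {lam : ℂ}
    (h : Module.End.HasEigenvalue (Matrix.toLin' (G.map (fun r : ℝ => (r : ℂ)))) lam) :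
    ∃ ℓ : EuclideanSpace ℝ (Fin N) →L[ℝ] ℂ, (∃ x, ℓ x ≠ 0) ∧
      ∀ x : EuclideanSpace ℝ (Fin N), ℓ (WithLp.toLp 2 (G.mulVec x.ofLp)) = lam * ℓ x := by
  set A : Matrix (Fin N) (Fin N) ℂ := G.map (fun r : ℝ => (r : ℂ))
  -- `A` and its transpose share a characteristic polynomial, so `lam` also has a left eigenvector.
  have h' : Module.End.HasEigenvalue (Matrix.toLin' A.transpose) lam := by
    rw [Module.End.hasEigenvalue_iff_isRoot_charpoly] at h ⊢
    rwa [Matrix.charpoly_toLin', Matrix.charpoly_transpose, ← Matrix.charpoly_toLin']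
  obtain ⟨w, hw⟩ := h'.exists_hasEigenvector
  have hwA : Matrix.vecMul w A = lam • w := by
    rw [← Matrix.mulVec_transpose, ← Matrix.toLin'_apply]
    exact hw.apply_eq_smul
  obtain ⟨i, hi⟩ := Function.ne_iff.1 hw.2
  let ℓ : EuclideanSpace ℝ (Fin N) →ₗ[ℝ] ℂ :=
    { toFun := fun x => w ⬝ᵥ fun j => (x j : ℂ)
      map_add' := fun x y => by simp [dotProduct, mul_add, Finset.sum_add_distrib]
      map_smul' := fun c x => by
        simp only [dotProduct, Finset.smul_sum, PiLp.smul_apply, smul_eq_mul, Complex.ofReal_mul,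
          RingHom.id_apply, Complex.real_smul]
        exact Finset.sum_congr rfl fun j _ => by ring }
  refine ⟨ℓ.toContinuousLinearMap, ⟨EuclideanSpace.single i 1, ?_⟩, fun x => ?_⟩
  · have : (fun j => ((EuclideanSpace.single i (1 : ℝ) : EuclideanSpace ℝ (Fin N)) j : ℂ)) =
        Pi.single i 1 := by
      ext j
      by_cases hj : j = i <;> simp [hj]
    change w ⬝ᵥ _ ≠ 0
    rw [this]
    simpa using hi
  · change w ⬝ᵥ (fun j => ((G.mulVec x.ofLp j : ℝ) : ℂ)) = lam * w ⬝ᵥ _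
    have : (fun j => ((G.mulVec x.ofLp j : ℝ) : ℂ)) = A.mulVec fun j => (x j : ℂ) := by
      ext j
      simp [Matrix.mulVec, dotProduct, A]
    rw [this, Matrix.dotProduct_mulVec, hwA, smul_dotProduct, smul_eq_mul]

/-- A complex number off the nonnegative real axis is `-μ²` with `0 < Re μ`. -/
theorem exists_neg_sq_eq_of_re_pos {lam : ℂ} (h : ¬ ∃ r : ℝ, 0 ≤ r ∧ lam = (r : ℂ)) :
    ∃ μ : ℂ, 0 < μ.re ∧ lam = -(μ ^ 2) := by
  obtain ⟨ν, hν⟩ := IsAlgClosed.exists_pow_nat_eq (-lam) two_pos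
  have hlam : lam = -(ν ^ 2) := by rw [hν, neg_neg]
  rcases lt_trichotomy ν.re 0 with h0 | h0 | h0
  · exact ⟨-ν, by simpa using h0, by rw [neg_sq, hlam]⟩
  -- For imaginary `ν`, `-ν² = (Im ν)²` is the excluded nonnegative real case.
  · refine (h ⟨ν.im ^ 2, sq_nonneg _, ?_⟩).elim
    rw [hlam]
    apply Complex.ext <;> simp [pow_two, h0]
  · exact ⟨ν, h0, hlam⟩

/-! ### Instability and the main theorem -/

section Instability

variable {N : ℕ} {G : Matrix (Fin N) (Fin N) ℝ} {t₀ : ℝ}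

/-- Off the bounded set of an unstable left eigenfunctional, trajectories grow exponentially. -/
theorem exp_growth_of_notMem_boundedObservable (ht₀ : 0 < t₀) {μ : ℂ} (hμ : 0 < μ.re)
    {ℓ : EuclideanSpace ℝ (Fin N) →L[ℝ] ℂ}
    (hℓ : ∀ x : EuclideanSpace ℝ (Fin N), ℓ (WithLp.toLp 2 (G.mulVec x.ofLp)) = -(μ ^ 2) * ℓ x)
    {z : EuclideanSpace ℝ (Fin N) × EuclideanSpace ℝ (Fin N)}
    (hz : z ∉ boundedObservable G t₀ ℓ) {q : ℝ → EuclideanSpace ℝ (Fin N)}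
    (hq : IsNAGDTrajectory G t₀ z.1 z.2 q) :
    ∃ C : ℝ, 0 < C ∧ ∀ᶠ t in atTop, C * Real.exp (μ.re / 2 * t) ≤ ‖q t‖ := by
  obtain ⟨u, -, hu⟩ := hq.exists_isScalarNAGD hℓ
  obtain ⟨t₁, ht₁, hJ⟩ : ∃ t₁ ∈ Ici t₀, 0 < IsScalarNAGD.corr μ (fun t => ℓ (q t)) u t₁ := by
    by_contra! hcon
    exact hz ⟨q, hq, hu.bounded_of_corr_nonpos ht₀ hμ hcon⟩
  obtain ⟨C, hC, hgrow⟩ := hu.exp_growth_of_corr_pos ht₀ hμ ht₁ hJ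
  refine ⟨C / (‖ℓ‖ + 1), by positivity, hgrow.mono fun t ht => ?_⟩
  rw [div_mul_eq_mul_div, div_le_iff₀ (by positivity)]
  have := ℓ.le_opNorm (q t)
  nlinarith [norm_nonneg (q t)]

theorem tendsto_atTop_of_exp_le {f : ℝ → ℝ} {C κ : ℝ} (hC : 0 < C) (hκ : 0 < κ)
    (h : ∀ᶠ t in atTop, C * Real.exp (κ * t) ≤ f t) : Tendsto f atTop atTop :=
  tendsto_atTop_mono' _ h
    ((Real.tendsto_exp_atTop.comp (tendsto_id.const_mul_atTop hκ)).const_mul_atTop hC)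

/-- Equal position and velocity `x` with `ℓ x ≠ 0` make the correlation positive already at `t₀`. -/
theorem boundedObservable_ne_top (ht₀ : 0 < t₀) {μ : ℂ} (hμ : 0 < μ.re)
    {ℓ : EuclideanSpace ℝ (Fin N) →L[ℝ] ℂ} (hℓ0 : ∃ x, ℓ x ≠ 0)
    (hℓ : ∀ x : EuclideanSpace ℝ (Fin N), ℓ (WithLp.toLp 2 (G.mulVec x.ofLp)) = -(μ ^ 2) * ℓ x) :
    boundedObservable G t₀ ℓ ≠ ⊤ := by
  intro htop
  obtain ⟨x, hx⟩ := hℓ0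
  obtain ⟨q, hq, M, hM⟩ :=
    mem_boundedObservable.1 (htop ▸ Submodule.mem_top : (x, x) ∈ boundedObservable G t₀ ℓ)
  obtain ⟨u, hu0, hu⟩ := hq.exists_isScalarNAGD hℓ
  have hq0 : q t₀ = x := hq.choose_spec.1
  have hJ : 0 < IsScalarNAGD.corr μ (fun t => ℓ (q t)) u t₀ := by
    have : IsScalarNAGD.corr μ (fun t => ℓ (q t)) u t₀ = μ.re * ‖ℓ x‖ ^ 2 := by
      simp only [IsScalarNAGD.corr, hu0, hq0, Complex.inner, Complex.sq_norm, Complex.normSq_apply]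
      simp
      ring
    rw [this]
    have := norm_pos_iff.2 hx
    positivity
  obtain ⟨C, hC, hgrow⟩ := hu.exp_growth_of_corr_pos ht₀ hμ self_mem_Ici hJ
  obtain ⟨t, ht, ht'⟩ := ((tendsto_atTop_of_exp_le hC (half_pos hμ) hgrow).eventually_gt_atTop M
    |>.and (eventually_ge_atTop t₀)).exists
  exact (hM t ht').not_gt ht

end Instability

theorem mainTheorem5 {N : ℕ} (G : Matrix (Fin N) (Fin N) ℝ) (t₀ : ℝ) (ht₀ : 0 < t₀)
    (hG : ∃ lam : ℂ,
      Module.End.HasEigenvalue (Matrix.toLin' (G.map (fun r : ℝ => (r : ℂ)))) lam ∧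
        ¬ ∃ r : ℝ, 0 ≤ r ∧ lam = (r : ℂ)) :
    -- every initial condition has a trajectory, unique on `[t₀, ∞)`
    (∀ q₀ v₀ : EuclideanSpace ℝ (Fin N),
      ∃ q : ℝ → EuclideanSpace ℝ (Fin N), IsNAGDTrajectory G t₀ q₀ v₀ q ∧
        ∀ p : ℝ → EuclideanSpace ℝ (Fin N), IsNAGDTrajectory G t₀ q₀ v₀ p →
          EqOn p q (Ici t₀)) ∧
    -- the exceptional set lies in a proper linear subspace
    (∃ S : Submodule ℝ (EuclideanSpace ℝ (Fin N) × EuclideanSpace ℝ (Fin N)),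
      S ≠ ⊤ ∧ Module.finrank ℝ S + 1 ≤ 2 * N ∧
        boundedInitialConditions G t₀ ⊆ (S : Set _)) ∧
    -- it is Lebesgue null
    volume (boundedInitialConditions G t₀) = 0 ∧
    -- its complement is open and dense
    (IsOpen (boundedInitialConditions G t₀)ᶜ ∧ Dense (boundedInitialConditions G t₀)ᶜ) ∧
    -- almost every trajectory tends to infinity in norm, exponentially
    (∃ κ : ℝ, 0 < κ ∧
      ∀ᵐ z : EuclideanSpace ℝ (Fin N) × EuclideanSpace ℝ (Fin N),
        ∃ q : ℝ → EuclideanSpace ℝ (Fin N), IsNAGDTrajectory G t₀ z.1 z.2 q ∧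
          Tendsto (fun t => ‖q t‖) atTop atTop ∧
          ∃ C : ℝ, 0 < C ∧ ∀ᶠ t in atTop, C * Real.exp (κ * t) ≤ ‖q t‖) := by
  obtain ⟨lam, hlam, hneg⟩ := hG
  obtain ⟨μ, hμ, rfl⟩ := exists_neg_sq_eq_of_re_pos hneg
  obtain ⟨ℓ, hℓ0, hℓ⟩ := exists_left_eigenfunctional hlam
  have hS : boundedObservable G t₀ ℓ ≠ ⊤ := boundedObservable_ne_top ht₀ hμ hℓ0 hℓ
  have hle := boundedObservable_id_le G t₀ ℓ
  have hnull : ∀ S : Submodule ℝ (EuclideanSpace ℝ (Fin N) × EuclideanSpace ℝ (Fin N)),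
      S ≠ ⊤ → volume (S : Set (EuclideanSpace ℝ (Fin N) × EuclideanSpace ℝ (Fin N))) = 0 :=
    fun S hS => by
      rw [Measure.volume_eq_prod]
      exact Measure.addHaar_submodule _ S hS
  -- The bounded set is itself a subspace, hence proper too: nullity, openness and density are read
  -- off from it, while almost-everywhere growth uses the larger subspace of `ℓ`.
  have hE : boundedObservable G t₀ (ContinuousLinearMap.id ℝ _) ≠ ⊤ := fun h =>
    hS (top_le_iff.1 (h ▸ hle))
  refine ⟨fun q₀ v₀ => ?_, ⟨boundedObservable G t₀ ℓ, hS, ?_, hle⟩, ?_, ⟨?_, ?_⟩,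
    μ.re / 2, half_pos hμ, ?_⟩
  · obtain ⟨q, hq⟩ := IsNAGDTrajectory.exists_trajectory G ht₀ q₀ v₀
    exact ⟨q, hq, fun p hp => hp.eqOn ht₀ hq⟩
  · have := Submodule.finrank_lt hS
    rw [Module.finrank_prod, finrank_euclideanSpace_fin] at this
    omega
  · exact hnull _ hE
  · rw [← coe_boundedObservable_id]
    exact (Submodule.closed_of_finiteDimensional _).isOpen_compl
  · rw [← coe_boundedObservable_id, ← interior_eq_empty_iff_dense_compl]
    by_contra hne
    exact hE (Submodule.eq_top_of_nonempty_interior' _ (nonempty_iff_ne_empty.2 hne))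
  · have hae : ∀ᵐ z : EuclideanSpace ℝ (Fin N) × EuclideanSpace ℝ (Fin N),
        z ∉ boundedObservable G t₀ ℓ := measure_eq_zero_iff_ae_notMem.1 (hnull _ hS)
    filter_upwards [hae] with z hz
    obtain ⟨q, hq⟩ := IsNAGDTrajectory.exists_trajectory G ht₀ z.1 z.2
    obtain ⟨C, hC, hgrow⟩ := exp_growth_of_notMem_boundedObservable ht₀ hμ hℓ hz hq
    exact ⟨q, hq, tendsto_atTop_of_exp_le hC (half_pos hμ) hgrow, C, hC, hgrow⟩
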